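/- Let $M$ be an $m$-dimensional smooth manifold without boundary, Hausdorff and paracompact (in particular, any second countable Hausdorff one), let $A=C^\infty(M)$ be the $\mathbb{R}$-algebra of smooth real-valued functions on $M$, and let $r\ge 0$ be an integer. An $\mathbb{R}$-linear map $D:A\to A$ is called a differential operator of order $\le 0$ if it is multiplication by an element of $A$, and, for $s\ge 1$, a differential operator of order $\le s$ if for every $a\in A$ the map $b\mapsto D(ab)-a\,D(b)$ is a differential operator of order $\le s-1$. A derivation of order $\le r$ on $A$ is a differential operator of order $\le r$ that vanishes on the constant functions. Let $\mathrm{Der}(A)$ be the space of $\mathbb{R}$-linear derivations of $A$ (the smooth vector fields on $M$), let $\mathrm{SDer}(A)$ be the (not necessarily unital) subalgebra of the algebra of $\mathbb{R}$-linear maps $A\to A$ under composition that is generated by $\mathrm{Der}(A)$, and let $\mathrm{SDer}^r(A)$ be the set of elements of $\mathrm{SDer}(A)$ that are (finite) $\mathbb{R}$-linear combinations of compositions $X_1\circ\cdots\circ X_s$ with $X_i\in\mathrm{Der}(A)$ and $1\le s\le r$. Then every derivation of order $\le r$ on $C^\infty(M)$ belongs to $\mathrm{SDer}^r(C^\infty(M))$.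 -/

import Mathlib

open scoped Manifold ContDiff

namespace HigherDerivation

variable (k : Type*) [CommRing k] (A : Type*) [CommRing A] [Algebra k A]

/-- The `k`-linear map `D : A → A` is a differential operator of order `≤ r` on the commutative
`k`-algebra `A`: for `r = 0` it is multiplication by an element of `A`; for `r ≥ 1`, every map
`b ↦ D (a * b) - a * D b` is a differential operator of order `≤ r - 1`. -/
def IsDiffOp : ℕ → Module.End k A → Prop
  | 0, D => ∃ a : A, D = LinearMap.mulLeft k a
  | r + 1, D => ∀ a : A,
      IsDiffOp r (D ∘ₗ LinearMap.mulLeft k a - LinearMap.mulLeft k a ∘ₗ D)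

/-- A derivation of order `≤ r` is a differential operator of order `≤ r` that vanishes on the
scalars. -/
def IsHigherDerivation (r : ℕ) (D : Module.End k A) : Prop :=
  IsDiffOp k A r D ∧ ∀ c : k, D (algebraMap k A c) = 0

/-- `SDer(A)`: the subalgebra of the algebra of linear maps `A → A` under composition generated by
the derivations of `A`. It is not required to contain the identity. -/
noncomputable def SDer : NonUnitalSubalgebra k (Module.End k A) :=
  NonUnitalAlgebra.adjoin k (Set.range fun X : Derivation k A A => (X : A →ₗ[k] A))

/-- The compositions `X₁ ∘ ⋯ ∘ Xₛ` of derivations with `1 ≤ s ≤ n`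
(the product of `Module.End k A` is composition). -/
def derivationCompositions (n : ℕ) : Set (Module.End k A) :=
  {T | ∃ L : List (Derivation k A A), 1 ≤ L.length ∧ L.length ≤ n ∧
    T = (L.map fun X : Derivation k A A => ((X : A →ₗ[k] A) : Module.End k A)).prod}

/-- `SDerⁿ(A)`: the elements of `SDer(A)` that are `k`-linear combinations of compositions of at
most `n` (and at least one) derivations of `A`. -/
noncomputable def SDerLE (n : ℕ) : Submodule k (Module.End k A) :=
  (SDer k A).toSubmodule ⊓ Submodule.span k (derivationCompositions k A n)

end HigherDerivation

/-! An operator `D` of order at most `n` has a principal symbol, homogeneous of degree `n` in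
covectors, and the commutator `[D, a]` corresponds to differentiating it in the direction `da`.
Suppose finitely many functions `f i` and vector fields `X i` satisfy `Y = ∑ Y (f i) • X i` for
every derivation `Y`. Euler's identity for homogeneous polynomials then says that `n • D` and `∑ [D,
f i] ∘ X i` agree up to order `n - 1` (`IsDualBasis.orderLT_smul_sub_sum`). Induction on the order,
applied to the commutators and to the remainder, and division by `n` finish the proof
(`IsDualBasis.mem_span_of_orderLT`). The symbol itself never appears, only iterated commutators.

The geometric half is the existence of such a dual basis (`exists_isDualBasis`). The `f i` are the
components of an immersion into a space of dimension `2 m + 1`. Its differential is injective, so it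
has smooth local left inverses, which a partition of unity glues into the `X i`. Algebraic
derivations are tied to geometry by Hadamard's lemma: their values at a point are directional
derivatives. Since `M` may have uncountably many components, the immersion is built by well-ordered
recursion along a locally finite family, not by a countable process. -/

namespace HigherDerivation

/-! ### Differential operators through iterated commutators. -/

section Algebra

variable {k A : Type*} [Field k] [CommRing A] [Algebra k A]

/-- The commutator of a linear map with the multiplication by `a`. -/
def mulCommutator (D : Module.End k A) (a : A) : Module.End k A :=
  D ∘ₗ LinearMap.mulLeft k a - LinearMap.mulLeft k a ∘ₗ D

theorem mulCommutator_apply (D : Module.End k A) (a b : A) :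
    mulCommutator D a b = D (a * b) - a * D b := rfl

/-- `D` is a differential operator of order `< n`; the only one of order `< 0` is zero. -/
def OrderLT : ℕ → Module.End k A → Prop
  | 0, D => D = 0
  | n + 1, D => ∀ a : A, OrderLT n (mulCommutator D a)

theorem mulCommutator_add (D E : Module.End k A) (a : A) :
    mulCommutator (D + E) a = mulCommutator D a + mulCommutator E a := by
  ext b; simp only [mulCommutator_apply, LinearMap.add_apply]; ring

theorem mulCommutator_smul (c : k) (D : Module.End k A) (a : A) :
    mulCommutator (c • D) a = c • mulCommutator D a := by
  ext b; simp only [mulCommutator_apply, LinearMap.smul_apply, smul_sub, mul_smul_comm]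

theorem mulCommutator_sub (D E : Module.End k A) (a : A) :
    mulCommutator (D - E) a = mulCommutator D a - mulCommutator E a := by
  ext b; simp only [mulCommutator_apply, LinearMap.sub_apply]; ring

theorem mulCommutator_sum {ι : Type*} (s : Finset ι) (D : ι → Module.End k A) (a : A) :
    mulCommutator (∑ i ∈ s, D i) a = ∑ i ∈ s, mulCommutator (D i) a := by
  ext b
  simp only [mulCommutator_apply, LinearMap.sum_apply, Finset.mul_sum, Finset.sum_sub_distrib]

theorem mulCommutator_comm (D : Module.End k A) (a b : A) :
    mulCommutator (mulCommutator D a) b = mulCommutator (mulCommutator D b) a := by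
  ext c
  simp only [mulCommutator_apply, mul_left_comm a b c]
  ring

theorem mulCommutator_mulLeft_comp (D : Module.End k A) (a b : A) :
    mulCommutator (LinearMap.mulLeft k a ∘ₗ D) b =
      LinearMap.mulLeft k a ∘ₗ mulCommutator D b := by
  ext c
  simp only [mulCommutator_apply, LinearMap.comp_apply, LinearMap.mulLeft_apply]
  ring

theorem mulCommutator_mulLeft (a b : A) : mulCommutator (LinearMap.mulLeft k a) b = 0 := by
  ext c
  simp only [mulCommutator_apply, LinearMap.mulLeft_apply, LinearMap.zero_apply]
  ring

theorem mulCommutator_comp_derivation (D : Module.End k A) (X : Derivation k A A) (a : A) :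
    mulCommutator (D ∘ₗ (X : A →ₗ[k] A)) a = mulCommutator D a ∘ₗ (X : A →ₗ[k] A) +
      (LinearMap.mulLeft k (X a) ∘ₗ D + mulCommutator D (X a)) := by
  ext b
  simp only [mulCommutator_apply, LinearMap.comp_apply, LinearMap.mulLeft_apply,
    LinearMap.add_apply, Derivation.coeFn_coe, Derivation.leibniz, smul_eq_mul, map_add,
    mul_comm b (X a)]
  ring

theorem orderLT_zero (n : ℕ) : OrderLT n (0 : Module.End k A) := by
  induction n with
  | zero => rfl
  | succ n ih =>
    intro a
    have : mulCommutator (0 : Module.End k A) a = 0 := by ext b; simp [mulCommutator_apply]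
    rwa [this]

theorem OrderLT.add {n : ℕ} {D E : Module.End k A} (hD : OrderLT n D) (hE : OrderLT n E) :
    OrderLT n (D + E) := by
  induction n generalizing D E with
  | zero => rw [OrderLT] at *; simp [hD, hE]
  | succ n ih => intro a; rw [mulCommutator_add]; exact ih (hD a) (hE a)

theorem OrderLT.smul {n : ℕ} {D : Module.End k A} (c : k) (hD : OrderLT n D) :
    OrderLT n (c • D) := by
  induction n generalizing D with
  | zero => rw [OrderLT] at *; simp [hD]
  | succ n ih => intro a; rw [mulCommutator_smul]; exact ih (hD a)

theorem OrderLT.sub {n : ℕ} {D E : Module.End k A} (hD : OrderLT n D) (hE : OrderLT n E) :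
    OrderLT n (D - E) := by
  have e : D - E = D + (-1 : k) • E := by ext b; simp [sub_eq_add_neg]
  rw [e]
  exact hD.add (hE.smul (-1))

theorem OrderLT.sum {ι : Type*} {n : ℕ} {s : Finset ι} {D : ι → Module.End k A}
    (h : ∀ i ∈ s, OrderLT n (D i)) : OrderLT n (∑ i ∈ s, D i) :=
  Finset.sum_induction D (OrderLT n) (fun _ _ => OrderLT.add) (orderLT_zero n) h

theorem orderLT_mulLeft (n : ℕ) (a : A) : OrderLT (n + 1) (LinearMap.mulLeft k a) := by
  intro b
  rw [mulCommutator_mulLeft]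
  exact orderLT_zero n

theorem OrderLT.apply_eq_of_one {D : Module.End k A} (hD : OrderLT 1 D) (b : A) :
    D b = b * D 1 := by
  have h := LinearMap.congr_fun (hD b) 1
  rw [mulCommutator_apply, mul_one] at h
  exact sub_eq_zero.1 h

/-- The shift by one lets error terms of negative order be literally zero, so that the inductions
below can start there. -/
theorem IsDiffOp.orderLT {n : ℕ} {D : Module.End k A} (hD : IsDiffOp k A n D) :
    OrderLT (n + 1) D := by
  induction n generalizing D with
  | zero => obtain ⟨a, rfl⟩ := hD; exact orderLT_mulLeft 0 a
  | succ n ih => exact fun a => ih (hD a)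

/-- The derivation `a ↦ [D, a]` attached to a differential operator of order at most one. -/
def symbolDerivation (D : Module.End k A) (hD : OrderLT 2 D) : Derivation k A A :=
  Derivation.mk'
    { toFun := fun a => mulCommutator D a 1
      map_add' := fun a b => by
        simp only [mulCommutator_apply, mul_one, map_add]; ring
      map_smul' := fun c a => by
        simp only [mulCommutator_apply, mul_one, map_smul, RingHom.id_apply, smul_sub,
          smul_mul_assoc] }
    fun a b => by
      have h := OrderLT.apply_eq_of_one (hD a) b
      simp only [mulCommutator_apply, mul_one] at h
      simp only [LinearMap.coe_mk, AddHom.coe_mk, mulCommutator_apply, mul_one, smul_eq_mul]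
      linear_combination h

/-! ### Dual bases and Euler's identity. -/

variable {ι : Type*} [Fintype ι]

/-- The finitely many functions `f i` and derivations `X i` form a dual basis of the module of
derivations. -/
def IsDualBasis (f : ι → A) (X : ι → Derivation k A A) : Prop :=
  ∀ (Y : Derivation k A A) (a : A), Y a = ∑ i, Y (f i) * X i a

/-- This is the chain rule for symbols. For `n = 0` the map `a ↦ [D, a] 1` is a derivation, which
the dual basis expands; a further commutator with `b` passes through every term and lowers `n`. -/
theorem IsDualBasis.orderLT_sub_sum {f : ι → A} {X : ι → Derivation k A A}
    (h : IsDualBasis f X) (a : A) {n : ℕ} {D : Module.End k A} (hD : OrderLT (n + 2) D) :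
    OrderLT n (mulCommutator D a - ∑ i, LinearMap.mulLeft k (X i a) ∘ₗ mulCommutator D (f i)) := by
  induction n generalizing D with
  | zero =>
    rw [OrderLT]
    ext b
    have h1 := h (symbolDerivation D hD) a
    change mulCommutator D a 1 = ∑ i, mulCommutator D (f i) 1 * X i a at h1
    simp only [LinearMap.sub_apply, LinearMap.sum_apply, LinearMap.comp_apply,
      LinearMap.mulLeft_apply, LinearMap.zero_apply]
    rw [OrderLT.apply_eq_of_one (hD a) b, h1, Finset.mul_sum, sub_eq_zero]
    refine Finset.sum_congr rfl fun i _ => ?_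
    rw [OrderLT.apply_eq_of_one (hD (f i)) b]
    ring
  | succ n ih =>
    intro b
    rw [mulCommutator_sub, mulCommutator_sum]
    simp only [mulCommutator_mulLeft_comp, mulCommutator_comm D _ b]
    exact ih (hD b)

theorem IsDualBasis.orderLT_smul_sub_sum {f : ι → A} {X : ι → Derivation k A A}
    (h : IsDualBasis f X) {n : ℕ} {D : Module.End k A} (hD : OrderLT (n + 1) D) :
    OrderLT n ((n : k) • D - ∑ i, mulCommutator D (f i) ∘ₗ (X i : A →ₗ[k] A)) := by
  induction n generalizing D with
  | zero =>
    have h0 : ∀ a, mulCommutator D a = 0 := fun a => hD a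
    simp [OrderLT, h0]
  | succ n ih =>
    intro a
    -- The coefficient splits as `n + 1`: the part `n` is the induction hypothesis for `[D, a]`, the
    -- part `1` is the chain rule above. The double commutators already have low enough order.
    have e : mulCommutator (((n + 1 : ℕ) : k) • D -
          ∑ i, mulCommutator D (f i) ∘ₗ (X i : A →ₗ[k] A)) a =
        ((n : k) • mulCommutator D a -
          ∑ i, mulCommutator (mulCommutator D a) (f i) ∘ₗ (X i : A →ₗ[k] A)) +
        (mulCommutator D a - ∑ i, LinearMap.mulLeft k (X i a) ∘ₗ mulCommutator D (f i)) -
        ∑ i, mulCommutator (mulCommutator D (f i)) (X i a) := by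
      rw [mulCommutator_sub, mulCommutator_smul, mulCommutator_sum]
      simp only [mulCommutator_comp_derivation, Finset.sum_add_distrib,
        mulCommutator_comm D _ a, Nat.cast_add, Nat.cast_one, add_smul, one_smul]
      abel
    rw [e]
    exact ((ih (hD a)).add (h.orderLT_sub_sum a hD)).sub
      (OrderLT.sum fun i _ => hD (f i) (X i a))

/-- The intersection in `SDerLE` therefore imposes nothing beyond the span. -/
theorem span_derivationCompositions_le_SDer (n : ℕ) :
    Submodule.span k (derivationCompositions k A n) ≤ (SDer k A).toSubmodule := by
  rw [Submodule.span_le]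
  rintro T ⟨L, hL, -, rfl⟩
  induction L with
  | nil => simp at hL
  | cons X L ih =>
    have hX : ((X : A →ₗ[k] A) : Module.End k A) ∈ SDer k A :=
      NonUnitalAlgebra.subset_adjoin k ⟨X, rfl⟩
    rcases L.eq_nil_or_concat with rfl | ⟨L', Y, rfl⟩
    · simpa using hX
    · rw [List.map_cons, List.prod_cons]
      exact (SDer k A).mul_mem' hX (ih (by simp))

theorem derivationCompositions_mono {n p : ℕ} (h : n ≤ p) :
    derivationCompositions k A n ⊆ derivationCompositions k A p := by
  rintro T ⟨L, h1, h2, h3⟩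
  exact ⟨L, h1, h2.trans h, h3⟩

theorem comp_derivation_mem_span {n : ℕ} {D : Module.End k A}
    (hD : D ∈ Submodule.span k (derivationCompositions k A n)) (X : Derivation k A A) :
    D ∘ₗ (X : A →ₗ[k] A) ∈ Submodule.span k (derivationCompositions k A (n + 1)) := by
  induction hD using Submodule.span_induction with
  | mem T hT =>
    obtain ⟨L, h1, h2, rfl⟩ := hT
    refine Submodule.subset_span ⟨L ++ [X], by simp, by simpa using h2, ?_⟩
    simp [Module.End.mul_eq_comp]
  | zero => simp
  | add D E _ _ hD hE => rw [LinearMap.add_comp]; exact add_mem hD hE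
  | smul c D _ hD => rw [LinearMap.smul_comp]; exact Submodule.smul_mem _ c hD

theorem mulLeft_comp_derivation_mem_span (n : ℕ) (a : A) (X : Derivation k A A) :
    LinearMap.mulLeft k a ∘ₗ (X : A →ₗ[k] A) ∈
      Submodule.span k (derivationCompositions k A (n + 1)) := by
  refine Submodule.subset_span ⟨[a • X], by simp, by simp, ?_⟩
  ext b
  simp

theorem IsDualBasis.mem_span_of_orderLT [CharZero k] {f : ι → A} {X : ι → Derivation k A A}
    (h : IsDualBasis f X) {n : ℕ} {D : Module.End k A} (hD : OrderLT (n + 1) D) (h1 : D 1 = 0) :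
    D ∈ Submodule.span k (derivationCompositions k A n) := by
  induction n generalizing D with
  | zero =>
    have : D = 0 := by ext b; simp [OrderLT.apply_eq_of_one hD b, h1]
    simp [this]
  | succ n ih =>
    have hc (i : ι) : mulCommutator D (f i) ∘ₗ (X i : A →ₗ[k] A) ∈
        Submodule.span k (derivationCompositions k A (n + 1)) := by
      set P := mulCommutator D (f i)
      -- Removing `P 1` makes the operator kill constants, as the induction requires; the removed
      -- part composed with `X i` is the single derivation `P 1 • X i`.
      have hP : P - LinearMap.mulLeft k (P 1) ∈
          Submodule.span k (derivationCompositions k A n) :=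
        ih ((hD (f i)).sub (orderLT_mulLeft n (P 1))) (by simp)
      have := add_mem (comp_derivation_mem_span hP (X i))
        (mulLeft_comp_derivation_mem_span n (P 1) (X i))
      rwa [← LinearMap.add_comp, sub_add_cancel] at this
    have hs := Submodule.sum_mem (Submodule.span k (derivationCompositions k A (n + 1)))
      fun i (_ : i ∈ Finset.univ) => hc i
    have hR := Submodule.span_mono (derivationCompositions_mono n.le_succ)
      (ih (h.orderLT_smul_sub_sum hD) (by simp [h1]))
    have := add_mem hR hs
    rw [sub_add_cancel] at this
    exact (Submodule.smul_mem_iff _ (Nat.cast_ne_zero.2 n.succ_ne_zero)).1 this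

theorem IsDualBasis.mem_SDerLE [CharZero k] {f : ι → A} {X : ι → Derivation k A A}
    (h : IsDualBasis f X) {n : ℕ} {D : Module.End k A} (hD : IsHigherDerivation k A n D) :
    D ∈ SDerLE k A n := by
  have hD' := h.mem_span_of_orderLT hD.1.orderLT (by simpa using hD.2 1)
  exact ⟨span_derivationCompositions_le_SDer n hD', hD'⟩

end Algebra

end HigherDerivation

namespace HigherDerivation

/-! ### Parametric integrals and Hadamard's lemma. -/

section Calculus

open MeasureTheory

universe u

/-- Differentiating under the integral gives an integral of the same kind with values in `E →L[ℝ]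
F`. Hence the induction generalizes `F`, and `E` and `F` share a universe. -/
theorem contDiff_nat_integral {E : Type u} [NormedAddCommGroup E] [NormedSpace ℝ E]
    [ProperSpace E] (n : ℕ) {F : Type u} [NormedAddCommGroup F] [NormedSpace ℝ F]
    {G : E × ℝ → F} (hG : ContDiff ℝ ∞ G) :
    ContDiff ℝ n fun y => ∫ t in (0 : ℝ)..1, G (y, t) := by
  induction n generalizing F with
  | zero =>
    rw [Nat.cast_zero, contDiff_zero]
    exact intervalIntegral.continuous_parametric_intervalIntegral_of_continuous'
      (f := fun y t => G (y, t)) hG.continuous 0 1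
  | succ n ih =>
    have hG' : ContDiff ℝ ∞ fun p => (fderiv ℝ G p).comp (ContinuousLinearMap.inl ℝ E ℝ) :=
      (hG.fderiv_right (m := ∞) (by simp)).clm_comp contDiff_const
    rw [Nat.cast_succ, contDiff_succ_iff_hasFDerivAt]
    refine ⟨_, ih hG', fun x => ?_⟩
    obtain ⟨C, hC⟩ := ((isCompact_closedBall x 1).prod (isCompact_Icc (a := (0 : ℝ)) (b := 1))
      ).exists_bound_of_continuousOn hG'.continuous.continuousOn
    refine intervalIntegral.hasFDerivAt_integral_of_dominated_of_fderiv_le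
      (F := fun y t => G (y, t)) (bound := fun _ => C)
      (F' := fun y t => (fderiv ℝ G (y, t)).comp (ContinuousLinearMap.inl ℝ E ℝ))
      (Metric.closedBall_mem_nhds x one_pos) ?_ ?_ ?_ ?_ ?_ ?_
    · exact Filter.Eventually.of_forall fun y =>
        (hG.continuous.comp (Continuous.prodMk_right y)).aestronglyMeasurable
    · exact (hG.continuous.comp (Continuous.prodMk_right x)).intervalIntegrable 0 1
    · exact (hG'.continuous.comp (Continuous.prodMk_right x)).aestronglyMeasurable
    · refine Filter.Eventually.of_forall fun t ht y hy => hC (y, t) ⟨hy, ?_⟩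
      rw [Set.uIoc_of_le zero_le_one] at ht
      exact Set.Ioc_subset_Icc_self ht
    · exact intervalIntegrable_const
    · refine Filter.Eventually.of_forall fun t _ y _ => ?_
      exact ((hG.differentiable (by simp)) (y, t)).hasFDerivAt.comp y (hasFDerivAt_prodMk_left y t)

/-- Hadamard's lemma. -/
theorem exists_contDiff_sub_eq {E : Type} [NormedAddCommGroup E] [NormedSpace ℝ E]
    [ProperSpace E] {f : E → ℝ} (hf : ContDiff ℝ ∞ f) (y₀ : E) :
    ∃ h : E → E →L[ℝ] ℝ, ContDiff ℝ ∞ h ∧ h y₀ = fderiv ℝ f y₀ ∧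
      ∀ y, f y - f y₀ = h y (y - y₀) := by
  have hf' : ContDiff ℝ ∞ (fderiv ℝ f) := hf.fderiv_right (by simp)
  have hG : ContDiff ℝ ∞ fun p : E × ℝ => fderiv ℝ f (y₀ + p.2 • (p.1 - y₀)) :=
    hf'.comp (contDiff_const.add (contDiff_snd.smul (contDiff_fst.sub contDiff_const)))
  refine ⟨fun y => ∫ t in (0 : ℝ)..1, fderiv ℝ f (y₀ + t • (y - y₀)),
    contDiff_infty.2 fun n => contDiff_nat_integral n hG, by simp, fun y => ?_⟩
  have hc : Continuous fun t : ℝ => fderiv ℝ f (y₀ + t • (y - y₀)) :=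
    hG.continuous.comp (Continuous.prodMk_right y)
  rw [ContinuousLinearMap.intervalIntegral_apply (hc.intervalIntegrable 0 1)]
  have hd : ∀ t ∈ Set.uIcc (0 : ℝ) 1, HasDerivAt (fun t : ℝ => f (y₀ + t • (y - y₀)))
      (fderiv ℝ f (y₀ + t • (y - y₀)) (y - y₀)) t := by
    intro t _
    have h1 : HasDerivAt (fun t : ℝ => y₀ + t • (y - y₀)) (y - y₀) t := by
      simpa using ((hasDerivAt_id t).smul_const (y - y₀)).const_add y₀
    exact ((hf.differentiable (by simp)) _).hasFDerivAt.comp_hasDerivAt t h1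
  rw [intervalIntegral.integral_eq_sub_of_hasDerivAt hd
    ((hc.clm_apply continuous_const).intervalIntegrable 0 1)]
  simp

end Calculus

end HigherDerivation

namespace HigherDerivation

open Filter Set Topology

/-! ### Point derivations are directional derivatives. -/

section PointDerivation

variable {m : ℕ} {M : Type*} [TopologicalSpace M] [ChartedSpace (EuclideanSpace ℝ (Fin m)) M]

/-- The product of a smooth function with a function that is smooth on its closed support. -/
noncomputable def mulOfTsupport (F : C^∞⟮𝓡 m, M; ℝ⟯) (g : M → ℝ)
    (hg : ∀ x ∈ tsupport F, ContMDiffAt (𝓡 m) 𝓘(ℝ, ℝ) ∞ g x) : C^∞⟮𝓡 m, M; ℝ⟯ :=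
  ⟨fun x => F x * g x, contMDiff_of_tsupport fun x hx =>
    (F.contMDiff x).mul (hg x (tsupport_mul_subset_left hx))⟩

/-- A linear functional on smooth functions satisfying the Leibniz rule at the point `x`. -/
def IsPointDerivation (x : M) (v : C^∞⟮𝓡 m, M; ℝ⟯ →ₗ[ℝ] ℝ) : Prop :=
  ∀ a b, v (a * b) = a x * v b + b x * v a

theorem IsPointDerivation.map_one {x : M} {v : C^∞⟮𝓡 m, M; ℝ⟯ →ₗ[ℝ] ℝ}
    (hv : IsPointDerivation x v) : v 1 = 0 := by
  have h := hv 1 1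
  simpa using h

theorem IsPointDerivation.map_algebraMap {x : M} {v : C^∞⟮𝓡 m, M; ℝ⟯ →ₗ[ℝ] ℝ}
    (hv : IsPointDerivation x v) (r : ℝ) : v (algebraMap ℝ _ r) = 0 := by
  rw [Algebra.algebraMap_eq_smul_one, map_smul, hv.map_one, smul_zero]

theorem mem_target_of_mem_source {c x : M}
    (hx : x ∈ (chartAt (EuclideanSpace ℝ (Fin m)) c).source) :
    extChartAt (𝓡 m) c x ∈ (extChartAt (𝓡 m) c).target :=
  (extChartAt (𝓡 m) c).map_source (by rwa [extChartAt_source])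

theorem symm_extChartAt_apply {c x : M}
    (hx : x ∈ (chartAt (EuclideanSpace ℝ (Fin m)) c).source) :
    (extChartAt (𝓡 m) c).symm (extChartAt (𝓡 m) c x) = x :=
  (extChartAt (𝓡 m) c).left_inv (by rwa [extChartAt_source])

theorem tendsto_symm_extChartAt {c x : M}
    (hx : x ∈ (chartAt (EuclideanSpace ℝ (Fin m)) c).source) :
    Tendsto (extChartAt (𝓡 m) c).symm (𝓝 (extChartAt (𝓡 m) c x)) (𝓝 x) := by
  have h := continuousAt_extChartAt_symm'' (I := 𝓡 m) (mem_target_of_mem_source hx)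
  rwa [ContinuousAt, symm_extChartAt_apply hx] at h

variable [IsManifold (𝓡 m) ∞ M]

theorem contDiffAt_comp_symm (c : M) (a : C^∞⟮𝓡 m, M; ℝ⟯) {y : EuclideanSpace ℝ (Fin m)}
    (hy : y ∈ (extChartAt (𝓡 m) c).target) :
    ContDiffAt ℝ ∞ (a ∘ (extChartAt (𝓡 m) c).symm) y :=
  (a.contMDiff.comp_contMDiffOn (contMDiffOn_extChartAt_symm c)).contDiffOn.contDiffAt
    ((isOpen_extChartAt_target c).mem_nhds hy)

theorem differentiableAt_comp_symm (a : C^∞⟮𝓡 m, M; ℝ⟯) {c x : M}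
    (hx : x ∈ (chartAt (EuclideanSpace ℝ (Fin m)) c).source) :
    DifferentiableAt ℝ (a ∘ (extChartAt (𝓡 m) c).symm) (extChartAt (𝓡 m) c x) :=
  (contDiffAt_comp_symm c a (mem_target_of_mem_source hx)).differentiableAt (by simp)

theorem contMDiffAt_extChartAt_coord {c x : M}
    (hx : x ∈ (chartAt (EuclideanSpace ℝ (Fin m)) c).source) (j : Fin m) :
    ContMDiffAt (𝓡 m) 𝓘(ℝ, ℝ) ∞ (fun z => extChartAt (𝓡 m) c z j) x :=
  (EuclideanSpace.proj j : EuclideanSpace ℝ (Fin m) →L[ℝ] ℝ).contDiff.contMDiff.contMDiffAt.comp x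
    (contMDiffAt_extChartAt' hx)

/-- The derivative at `x` in the direction with coordinates `w` in the chart at `c`. -/
noncomputable def chartDeriv {c x : M}
    (hx : x ∈ (chartAt (EuclideanSpace ℝ (Fin m)) c).source) (w : EuclideanSpace ℝ (Fin m)) :
    C^∞⟮𝓡 m, M; ℝ⟯ →ₗ[ℝ] ℝ where
  toFun a := fderiv ℝ (a ∘ (extChartAt (𝓡 m) c).symm) (extChartAt (𝓡 m) c x) w
  map_add' a b := by
    have h := fderiv_add (differentiableAt_comp_symm a hx) (differentiableAt_comp_symm b hx)
    exact congrArg (fun L => L w) h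
  map_smul' r a := by
    have h := fderiv_const_smul (differentiableAt_comp_symm a hx) r
    exact congrArg (fun L => L w) h

theorem chartDeriv_apply {c x : M}
    (hx : x ∈ (chartAt (EuclideanSpace ℝ (Fin m)) c).source) (w : EuclideanSpace ℝ (Fin m))
    (a : C^∞⟮𝓡 m, M; ℝ⟯) : chartDeriv hx w a =
      fderiv ℝ (a ∘ (extChartAt (𝓡 m) c).symm) (extChartAt (𝓡 m) c x) w := rfl

theorem isPointDerivation_chartDeriv {c x : M}
    (hx : x ∈ (chartAt (EuclideanSpace ℝ (Fin m)) c).source) (w : EuclideanSpace ℝ (Fin m)) :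
    IsPointDerivation x (chartDeriv hx w) := by
  intro a b
  have h := fderiv_mul (differentiableAt_comp_symm a hx) (differentiableAt_comp_symm b hx)
  have h' := congrArg (fun L => L w) h
  simp only [add_apply, smul_apply, smul_eq_mul, Function.comp_apply,
    symm_extChartAt_apply hx] at h'
  exact h'

theorem chartDeriv_congr {c x : M}
    (hx : x ∈ (chartAt (EuclideanSpace ℝ (Fin m)) c).source) (w : EuclideanSpace ℝ (Fin m))
    {a b : C^∞⟮𝓡 m, M; ℝ⟯} (h : a =ᶠ[𝓝 x] b) : chartDeriv hx w a = chartDeriv hx w b := by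
  rw [chartDeriv_apply, chartDeriv_apply,
    Filter.EventuallyEq.fderiv_eq (h.comp_tendsto (tendsto_symm_extChartAt hx))]

/-- Extension by zero is smooth because the image of the compact support is closed. Having a
function on the whole space spares Hadamard's lemma any star-shaped domain. -/
theorem exists_contDiff_eqOn_target {c : M} {χ : C^∞⟮𝓡 m, M; ℝ⟯}
    (hs : tsupport χ ⊆ (chartAt (EuclideanSpace ℝ (Fin m)) c).source)
    (hc : IsCompact (tsupport χ)) :
    ∃ f : EuclideanSpace ℝ (Fin m) → ℝ, ContDiff ℝ ∞ f ∧
      EqOn f (χ ∘ (extChartAt (𝓡 m) c).symm) (extChartAt (𝓡 m) c).target := by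
  classical
  set φ := extChartAt (𝓡 m) c
  refine ⟨indicator φ.target (χ ∘ φ.symm), contDiff_iff_contDiffAt.2 fun y => ?_,
    fun y hy => indicator_of_mem hy _⟩
  by_cases hy : y ∈ φ.target
  · refine (contDiffAt_comp_symm c χ hy).congr_of_eventuallyEq ?_
    filter_upwards [(isOpen_extChartAt_target c).mem_nhds hy] with z hz
    exact indicator_of_mem hz _
  · have hK : IsCompact (φ '' tsupport χ) :=
      hc.image_of_continuousOn ((continuousOn_extChartAt c).mono (by rwa [extChartAt_source]))
    have hyK : y ∉ φ '' tsupport χ := by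
      rintro ⟨x, hx, rfl⟩
      exact hy (mem_target_of_mem_source (hs hx))
    refine (contDiffAt_const (c := (0 : ℝ))).congr_of_eventuallyEq ?_
    filter_upwards [hK.isClosed.isOpen_compl.mem_nhds hyK] with z hz
    by_cases hzt : z ∈ φ.target
    · rw [indicator_of_mem hzt]
      by_contra hne
      exact hz ⟨φ.symm z, subset_tsupport _ hne, φ.right_inv hzt⟩
    · exact indicator_of_notMem hzt _

variable [T2Space M]

theorem exists_bump {x : M} {s : Set M} (hs : s ∈ 𝓝 x) :
    ∃ χ : C^∞⟮𝓡 m, M; ℝ⟯, χ =ᶠ[𝓝 x] 1 ∧ tsupport χ ⊆ s ∧ IsCompact (tsupport χ) := by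
  obtain ⟨χ, -, hχ⟩ := (SmoothBumpFunction.nhds_basis_tsupport (I := 𝓡 m) x).mem_iff.1 hs
  exact ⟨⟨χ, χ.contMDiff⟩, χ.eventuallyEq_one, hχ, χ.hasCompactSupport⟩

theorem eq_zero_of_chartDeriv_eq_zero {c x : M}
    (hx : x ∈ (chartAt (EuclideanSpace ℝ (Fin m)) c).source) {w : EuclideanSpace ℝ (Fin m)}
    (h : chartDeriv hx w = 0) : w = 0 := by
  obtain ⟨χ, h1, hs, -⟩ := exists_bump (m := m)
    ((chartAt (EuclideanSpace ℝ (Fin m)) c).open_source.mem_nhds hx)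
  ext j
  have hj := LinearMap.congr_fun h (mulOfTsupport χ (fun z => extChartAt (𝓡 m) c z j)
    fun z hz => contMDiffAt_extChartAt_coord (hs hz) j)
  rw [chartDeriv_apply, LinearMap.zero_apply] at hj
  have e : (mulOfTsupport χ (fun z => extChartAt (𝓡 m) c z j)
      fun z hz => contMDiffAt_extChartAt_coord (hs hz) j) ∘ (extChartAt (𝓡 m) c).symm
      =ᶠ[𝓝 (extChartAt (𝓡 m) c x)] (EuclideanSpace.proj j : EuclideanSpace ℝ (Fin m) →L[ℝ] ℝ) := by
    filter_upwards [(tendsto_symm_extChartAt hx).eventually h1,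
      (isOpen_extChartAt_target c).mem_nhds (mem_target_of_mem_source hx)] with y hy hyt
    change χ ((extChartAt (𝓡 m) c).symm y) * _ = y j
    rw [hy]
    simp only [(extChartAt (𝓡 m) c).right_inv hyt, Pi.one_apply, one_mul]
  rw [e.fderiv_eq, ContinuousLinearMap.fderiv] at hj
  exact hj

/-- Every point derivation is a directional derivative. -/
theorem IsPointDerivation.exists_eq_chartDeriv {c x : M} {v : C^∞⟮𝓡 m, M; ℝ⟯ →ₗ[ℝ] ℝ}
    (hv : IsPointDerivation x v) (hx : x ∈ (chartAt (EuclideanSpace ℝ (Fin m)) c).source) :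
    ∃ w, v = chartDeriv hx w := by
  obtain ⟨χ, h1, hs, hc⟩ := exists_bump (m := m)
    ((chartAt (EuclideanSpace ℝ (Fin m)) c).open_source.mem_nhds hx)
  have hχx : χ x = 1 := h1.self_of_nhds
  let φ := extChartAt (𝓡 m) c
  let u (j : Fin m) : C^∞⟮𝓡 m, M; ℝ⟯ := mulOfTsupport χ (fun z => φ z j - φ x j)
    fun z hz => (contMDiffAt_extChartAt_coord (hs hz) j).sub contMDiffAt_const
  refine ⟨WithLp.toLp 2 fun j => v (u j), LinearMap.ext fun a => ?_⟩
  let b : C^∞⟮𝓡 m, M; ℝ⟯ := a - algebraMap ℝ _ (a x)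
  have hbx : b x = 0 := sub_self (a x)
  obtain ⟨f, hf, hfe⟩ := exists_contDiff_eqOn_target (c := c) (χ := χ * b)
    ((tsupport_mul_subset_left (f := χ) (g := b)).trans hs)
    (hc.of_isClosed_subset (isClosed_tsupport _) tsupport_mul_subset_left)
  obtain ⟨h, hh, hhx, hhe⟩ := exists_contDiff_sub_eq hf (φ x)
  let e (j : Fin m) : EuclideanSpace ℝ (Fin m) := EuclideanSpace.single j 1
  have he (y : EuclideanSpace ℝ (Fin m)) : y = ∑ j, y j • e j := by
    ext i; simp [e, Pi.single_apply]
  let g (j : Fin m) : C^∞⟮𝓡 m, M; ℝ⟯ := mulOfTsupport χ (fun z => h (φ z) (e j)) fun z hz =>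
    (hh.clm_apply contDiff_const).contMDiff.contMDiffAt.comp z (contMDiffAt_extChartAt' (hs hz))
  have hf0 : f (φ x) = 0 := by
    rw [hfe (mem_target_of_mem_source hx)]
    change χ (φ.symm (φ x)) * b (φ.symm (φ x)) = 0
    rw [symm_extChartAt_apply hx, hbx, mul_zero]
  -- Hadamard expands `χ * b`; the two extra factors `χ` turn the coordinates and the Hadamard
  -- coefficients into global functions. They do not affect `v`, since `χ x = 1` and `b x = 0`.
  have key : χ * (χ * (χ * b)) = ∑ j, u j * g j := by
    ext z
    rw [← ContMDiffMap.coeFnRingHom_apply, ← ContMDiffMap.coeFnRingHom_apply, map_sum,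
      Finset.sum_apply]
    change χ z * (χ z * (χ z * b z)) = ∑ j, (χ z * (φ z j - φ x j)) * (χ z * h (φ z) (e j))
    by_cases hz : z ∈ tsupport χ
    · have h2 := hhe (φ z)
      rw [hf0, sub_zero, hfe (mem_target_of_mem_source (hs hz)), he (φ z - φ x), map_sum] at h2
      have h3 : χ z * b z = ∑ j, (φ z j - φ x j) * h (φ z) (e j) := by
        have : ((χ * b : C^∞⟮𝓡 m, M; ℝ⟯) ∘ φ.symm) (φ z) = χ z * b z := by
          change χ (φ.symm (φ z)) * b (φ.symm (φ z)) = _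
          rw [symm_extChartAt_apply (hs hz)]
        rw [← this, h2]
        simp
      rw [h3, Finset.mul_sum, Finset.mul_sum]
      exact Finset.sum_congr rfl fun j _ => by ring
    · simp [image_eq_zero_of_notMem_tsupport hz]
  have hvb : v b = v a := by
    rw [map_sub, hv.map_algebraMap, sub_zero]
  have hux (j : Fin m) : u j x = 0 := by
    change χ x * (φ x j - φ x j) = 0
    simp
  have hgx (j : Fin m) : g j x = fderiv ℝ f (φ x) (e j) := by
    change χ x * h (φ x) (e j) = _
    rw [hχx, one_mul, hhx]
  have hm (p q : C^∞⟮𝓡 m, M; ℝ⟯) : (p * q) x = p x * q x := rfl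
  have hL : v (χ * (χ * (χ * b))) = v a := by
    simp only [hv _ _, hm, hbx, hχx, hvb]
    ring
  rw [← hL, key, map_sum]
  have hfd : fderiv ℝ f (φ x) = fderiv ℝ (a ∘ φ.symm) (φ x) := by
    have hev : f =ᶠ[𝓝 (φ x)] fun y => (a ∘ φ.symm) y - a x := by
      filter_upwards [(tendsto_symm_extChartAt hx).eventually h1,
        (isOpen_extChartAt_target c).mem_nhds (mem_target_of_mem_source hx)] with y hy hyt
      rw [hfe hyt]
      change χ (φ.symm y) * (a (φ.symm y) - a x) = _
      rw [hy]
      simp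
    rw [hev.fderiv_eq, fderiv_sub_const]
  rw [chartDeriv_apply, ← hfd, he (WithLp.toLp 2 fun j => v (u j)), map_sum]
  refine Finset.sum_congr rfl fun j _ => ?_
  rw [hv, hux, hgx, map_smul]
  simp [mul_comm]

theorem IsPointDerivation.congr {x : M} {v : C^∞⟮𝓡 m, M; ℝ⟯ →ₗ[ℝ] ℝ}
    (hv : IsPointDerivation x v) {a b : C^∞⟮𝓡 m, M; ℝ⟯} (h : a =ᶠ[𝓝 x] b) : v a = v b := by
  obtain ⟨w, rfl⟩ := hv.exists_eq_chartDeriv (mem_chart_source _ x)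
  exact chartDeriv_congr _ w h

end PointDerivation

end HigherDerivation

namespace HigherDerivation

open Filter Set Topology

/-! ### Locally finite families and an immersion. -/

section Immersion

variable {m : ℕ} {M : Type*} [TopologicalSpace M] [ChartedSpace (EuclideanSpace ℝ (Fin m)) M]

/-- The linear combination with coefficients `b` of a locally finite family of functions. -/
noncomputable def locallyFiniteComb {ι : Type*} (F : ι → C^∞⟮𝓡 m, M; ℝ⟯)
    (hF : LocallyFinite fun i => Function.support (F i)) (b : ι → ℝ) : C^∞⟮𝓡 m, M; ℝ⟯ :=
  ⟨fun x => ∑ᶠ i, (b i • F i) x, contMDiff_finsum (fun i => (b i • F i).contMDiff)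
    (hF.subset fun i x hx => by
      rw [Function.mem_support] at hx ⊢
      exact fun h => hx (by simp [h]))⟩

variable [IsManifold (𝓡 m) ∞ M]

/-- A dimension count: the derivative of `G + a F` does not vanish on the tangent vectors on which
that of `F` does not, for a suitable `a`. -/
theorem exists_coeff_chartDeriv_ne_zero (c : M) (F : C^∞⟮𝓡 m, M; ℝ⟯)
    (G : Fin (2 * m + 1) → C^∞⟮𝓡 m, M; ℝ⟯) : ∃ a : Fin (2 * m + 1) → ℝ,
      ∀ (x : M) (hx : x ∈ (chartAt (EuclideanSpace ℝ (Fin m)) c).source) w,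
        chartDeriv hx w F ≠ 0 → ∃ k, chartDeriv hx w (G k) + a k * chartDeriv hx w F ≠ 0 := by
  let E := EuclideanSpace ℝ (Fin m)
  let d (f : C^∞⟮𝓡 m, M; ℝ⟯) (p : E × E) : ℝ :=
    fderiv ℝ (f ∘ (extChartAt (𝓡 m) c).symm) p.1 p.2
  have hd (f) (p : E × E) (hp : p.1 ∈ (extChartAt (𝓡 m) c).target) : ContDiffAt ℝ 1 (d f) p := by
    have h1 : ContDiffAt ℝ 1 (fderiv ℝ (f ∘ (extChartAt (𝓡 m) c).symm)) p.1 :=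
      (contDiffAt_comp_symm c f hp).fderiv_right (by norm_cast)
    exact (h1.comp p contDiffAt_fst).clm_apply contDiffAt_snd
  let S : Set (E × E) := {p | p.1 ∈ (extChartAt (𝓡 m) c).target ∧ d F p ≠ 0}
  -- A vector `a` fails at `p` exactly when `a = Φ p`. As `Φ` is C¹ on a set in dimension `2 * m`,
  -- the bad vectors cannot fill dimension `2 * m + 1`.
  let Φ (p : E × E) (k : Fin (2 * m + 1)) : ℝ := -d (G k) p / d F p
  have hΦ (p) (hp : p ∈ S) : ContDiffAt ℝ 1 Φ p :=
    contDiffAt_pi.2 fun k => (hd (G k) p hp.1).neg.div (hd F p hp.1) hp.2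
  have hdim : dimH (Φ '' S) < Module.finrank ℝ (Fin (2 * m + 1) → ℝ) := by
    calc dimH (Φ '' S) ≤ dimH S := dimH_image_le_of_locally_lipschitzOn fun p hp =>
          let ⟨C, u, hu, hl⟩ := (hΦ p hp).exists_lipschitzOnWith
          ⟨C, u, mem_nhdsWithin_of_mem_nhds hu, hl⟩
      _ ≤ dimH (univ : Set (E × E)) := dimH_mono (subset_univ S)
      _ = Module.finrank ℝ (E × E) := Real.dimH_univ_eq_finrank (E × E)
      _ < Module.finrank ℝ (Fin (2 * m + 1) → ℝ) := by
          rw [Module.finrank_prod, Module.finrank_fin_fun, finrank_euclideanSpace_fin]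
          norm_cast
          lia
  obtain ⟨a, ha⟩ := (dense_compl_of_dimH_lt_finrank hdim).nonempty
  refine ⟨a, fun x hx w hw => ?_⟩
  by_contra! h
  refine ha ⟨(extChartAt (𝓡 m) c x, w), ⟨mem_target_of_mem_source hx, hw⟩, funext fun k => ?_⟩
  exact (div_eq_iff hw).2 (neg_eq_iff_add_eq_zero.2 (h k))

theorem exists_wellFounded_choice {ι V : Type*} [Zero V] [LinearOrder ι] [WellFoundedLT ι]
    (P : ι → (ι → V) → V → Prop) (hP : ∀ i b, ∃ a, P i b a) :
    ∃ a : ι → V, ∀ i, P i (fun j => if j < i then a j else 0) (a i) := by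
  choose p hp using hP
  let a : ι → V := (wellFounded_lt (α := ι)).fix
    fun i r => p i fun j => if h : j < i then r j h else 0
  refine ⟨a, fun i => ?_⟩
  have ha : a i = p i fun j => if j < i then a j else 0 := by
    change (wellFounded_lt (α := ι)).fix _ i = _
    rw [WellFounded.fix_eq]
    congr 1
  rw [ha]
  exact hp i _

variable [T2Space M]

/-- Refine the supports of bump functions to a locally finite open cover `W`, and in each chart take
a smooth function nonvanishing exactly on the part of `W c` there. Squaring makes it nonnegative. -/
theorem exists_locallyFinite_cover [ParacompactSpace M] (U : M → Set M) (hU : ∀ c, U c ∈ 𝓝 c) :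
    ∃ F : M → C^∞⟮𝓡 m, M; ℝ⟯, (∀ c, tsupport (F c) ⊆ U c) ∧
      (LocallyFinite fun c => Function.support (F c)) ∧ (∀ c x, 0 ≤ F c x) ∧
      ∀ x, ∃ c, F c x ≠ 0 := by
  have hb (c : M) := exists_bump (m := m) (inter_mem (hU c)
    ((chartAt (EuclideanSpace ℝ (Fin m)) c).open_source.mem_nhds (mem_chart_source _ c)))
  choose χ h1 hs hc using hb
  have hχc (c : M) : χ c c ≠ 0 := by rw [(h1 c).self_of_nhds]; exact one_ne_zero
  obtain ⟨W, hWo, hWc, hWf, hW⟩ := precise_refinement (fun c => Function.support (χ c))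
    (fun c => (χ c).contMDiff.continuous.isOpen_support)
    (iUnion_eq_univ_iff.2 fun c => ⟨c, hχc c⟩)
  have hg (c : M) := IsOpen.exists_contDiff_support_eq (n := ⊤)
    ((continuousOn_extChartAt_symm (I := 𝓡 m) c).isOpen_inter_preimage
      (isOpen_extChartAt_target c) (hWo c))
  choose g hgs hgd _ using hg
  let f (c : M) : C^∞⟮𝓡 m, M; ℝ⟯ := mulOfTsupport (χ c) (fun x => g c (extChartAt (𝓡 m) c x))
    fun x hx => (hgd c).contMDiff.contMDiffAt.comp x (contMDiffAt_extChartAt' (hs c hx).2)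
  have hf (c x : M) : f c x ≠ 0 ↔ x ∈ W c := by
    change χ c x * g c (extChartAt (𝓡 m) c x) ≠ 0 ↔ _
    rw [mul_ne_zero_iff]
    have key (hx : χ c x ≠ 0) : g c (extChartAt (𝓡 m) c x) ≠ 0 ↔ x ∈ W c := by
      have hx' := (hs c (subset_tsupport _ hx)).2
      rw [← Function.mem_support, hgs, mem_inter_iff, mem_preimage, symm_extChartAt_apply hx']
      exact and_iff_right (mem_target_of_mem_source hx')
    exact ⟨fun h => (key h.1).1 h.2, fun h => ⟨hW c h, (key (hW c h)).2 h⟩⟩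
  have hff (c x : M) : (f c * f c) x = f c x * f c x := rfl
  refine ⟨fun c => f c * f c, fun c => ?_, hWf.subset fun c x hx => ?_, fun c x => ?_, fun x => ?_⟩
  · exact (tsupport_mul_subset_left (f := f c) (g := f c)).trans
      ((tsupport_mul_subset_left (f := χ c)).trans ((hs c).trans inter_subset_left))
  · rw [Function.mem_support, hff] at hx
    exact (hf c x).1 (mul_self_ne_zero.1 hx)
  · rw [hff]; exact mul_self_nonneg _
  · obtain ⟨c, hx⟩ := iUnion_eq_univ_iff.1 hWc x
    exact ⟨c, by rw [hff]; exact mul_self_ne_zero.2 ((hf c x).2 hx)⟩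

theorem IsPointDerivation.map_locallyFiniteComb {ι : Type*} (F : ι → C^∞⟮𝓡 m, M; ℝ⟯)
    (hF : LocallyFinite fun i => Function.support (F i)) {x : M} {v : C^∞⟮𝓡 m, M; ℝ⟯ →ₗ[ℝ] ℝ}
    (hv : IsPointDerivation x v) : ∃ s : Finset ι, (∀ i ∉ s, v (F i) = 0) ∧
      ∀ b, v (locallyFiniteComb F hF b) = ∑ i ∈ s, b i * v (F i) := by
  obtain ⟨t, ht, hfin⟩ := hF x
  have h0 (i : ι) (hi : i ∉ hfin.toFinset) (y : M) (hy : y ∈ t) : F i y = 0 := by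
    by_contra hne
    exact hi (hfin.mem_toFinset.2 ⟨y, hne, hy⟩)
  refine ⟨hfin.toFinset, fun i hi => ?_, fun b => ?_⟩
  · rw [hv.congr (b := 0) (by filter_upwards [ht] with y hy using h0 i hi y hy), map_zero]
  · rw [hv.congr (b := ∑ i ∈ hfin.toFinset, b i • F i), map_sum]
    · simp
    · filter_upwards [ht] with y hy
      rw [← ContMDiffMap.coeFnRingHom_apply (∑ i ∈ hfin.toFinset, b i • F i), map_sum,
        Finset.sum_apply]
      refine finsum_eq_sum_of_support_subset _ fun i hi => ?_
      by_contra hne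
      exact hi (by simp [h0 i hne y hy])

/-- The family consists of cutoffs `ρ` (index `none`) and products `ρ y_j` with chart coordinates.
Where `ρ ≠ 0`, the rule `d(ρ y_j) = ρ dy_j + y_j dρ` recovers every coordinate of a tangent vector.
-/
theorem exists_coord_cover [ParacompactSpace M] :
    ∃ F : M × Option (Fin m) → C^∞⟮𝓡 m, M; ℝ⟯,
      (∀ i, tsupport (F i) ⊆ (chartAt (EuclideanSpace ℝ (Fin m)) i.1).source) ∧
      (LocallyFinite fun i => Function.support (F i)) ∧
      ∀ (x : M) (v : C^∞⟮𝓡 m, M; ℝ⟯ →ₗ[ℝ] ℝ), IsPointDerivation x v →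
        (∀ i, v (F i) = 0) → v = 0 := by
  obtain ⟨F, hs, hf, -, hc⟩ := exists_locallyFinite_cover (m := m)
    (fun c : M => (chartAt (EuclideanSpace ℝ (Fin m)) c).source)
    fun c => (chartAt (EuclideanSpace ℝ (Fin m)) c).open_source.mem_nhds (mem_chart_source _ c)
  let F' (i : M × Option (Fin m)) : C^∞⟮𝓡 m, M; ℝ⟯ :=
    i.2.elim (F i.1) fun j => mulOfTsupport (F i.1) (fun z => extChartAt (𝓡 m) i.1 z j)
      fun z hz => contMDiffAt_extChartAt_coord (hs i.1 hz) j
  have hsupp (i) : Function.support (F' i) ⊆ Function.support (F i.1) := by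
    obtain ⟨c, _ | j⟩ := i
    · exact subset_rfl
    · exact Function.support_mul_subset_left _ _
  refine ⟨F', fun i => (closure_mono (hsupp i)).trans (hs i.1), fun x => ?_, fun x v hv h => ?_⟩
  · obtain ⟨t, ht, hfin⟩ := hf x
    refine ⟨t, ht, (hfin.prod (finite_univ (α := Option (Fin m)))).subset ?_⟩
    rintro i ⟨y, hy, hyt⟩
    exact ⟨⟨y, hsupp i hy, hyt⟩, mem_univ _⟩
  · obtain ⟨c, hcx⟩ := hc x
    have hx := hs c (subset_tsupport _ hcx)
    obtain ⟨w, rfl⟩ := hv.exists_eq_chartDeriv hx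
    suffices hw : w = 0 by
      subst hw
      ext a
      rw [chartDeriv_apply, map_zero, LinearMap.zero_apply]
    ext j
    have h0 : chartDeriv hx w (F c) = 0 := h (c, none)
    have hj : chartDeriv hx w (F' (c, some j)) = 0 := h (c, some j)
    have e : F' (c, some j) ∘ (extChartAt (𝓡 m) c).symm =ᶠ[𝓝 (extChartAt (𝓡 m) c x)]
        (F c ∘ (extChartAt (𝓡 m) c).symm) *
          ⇑(EuclideanSpace.proj j : EuclideanSpace ℝ (Fin m) →L[ℝ] ℝ) := by
      filter_upwards [(isOpen_extChartAt_target c).mem_nhds (mem_target_of_mem_source hx)]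
        with y hy
      change F c _ * extChartAt (𝓡 m) c ((extChartAt (𝓡 m) c).symm y) j = F c _ * y j
      rw [(extChartAt (𝓡 m) c).right_inv hy]
    rw [chartDeriv_apply] at h0 hj
    rw [e.fderiv_eq, fderiv_mul (differentiableAt_comp_symm (F c) hx)
      (ContinuousLinearMap.differentiableAt _), ContinuousLinearMap.fderiv] at hj
    simp only [add_apply, smul_apply, h0, add_zero, Function.comp_apply,
      symm_extChartAt_apply hx, smul_eq_mul, mul_zero, mul_eq_zero, hcx, false_or] at hj
    exact hj

/-- A manifold of dimension `m` admits an immersion into a space of dimension `2 m + 1`. -/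
theorem exists_immersion [ParacompactSpace M] :
    ∃ f : Fin (2 * m + 1) → C^∞⟮𝓡 m, M; ℝ⟯,
      ∀ (x : M) (v : C^∞⟮𝓡 m, M; ℝ⟯ →ₗ[ℝ] ℝ), IsPointDerivation x v →
        (∀ k, v (f k) = 0) → v = 0 := by
  obtain ⟨F, hs, hf, hF⟩ := exists_coord_cover (m := m) (M := M)
  obtain ⟨_, _⟩ := exists_wellFoundedLT (M × Option (Fin m))
  obtain ⟨a, ha⟩ := exists_wellFounded_choice
    (fun (i : M × Option (Fin m)) (b : M × Option (Fin m) → Fin (2 * m + 1) → ℝ) a =>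
      ∀ (x : M) (hx : x ∈ (chartAt (EuclideanSpace ℝ (Fin m)) i.1).source) w,
        chartDeriv hx w (F i) ≠ 0 → ∃ k, chartDeriv hx w (locallyFiniteComb F hf fun j => b j k) +
          a k * chartDeriv hx w (F i) ≠ 0)
    fun i b => exists_coeff_chartDeriv_ne_zero i.1 (F i) fun k =>
      locallyFiniteComb F hf fun j => b j k
  refine ⟨fun k => locallyFiniteComb F hf fun i => a i k, fun x v hv h => ?_⟩
  by_contra hv0
  obtain ⟨s, hs0, hsum⟩ := hv.map_locallyFiniteComb F hf
  have hne : (s.filter fun i => v (F i) ≠ 0).Nonempty := by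
    by_contra hemp
    rw [Finset.not_nonempty_iff_eq_empty, Finset.filter_eq_empty_iff] at hemp
    refine hv0 (hF x v hv fun i => ?_)
    by_cases hi : i ∈ s
    · exact not_not.1 (hemp hi)
    · exact hs0 i hi
  -- At the largest index `i` with `v (F i) ≠ 0` later terms contribute nothing, so `v (f k)` is
  -- exactly the quantity that the choice of `a i` keeps from vanishing for all `k`.
  obtain ⟨i, hi, hmax⟩ := Finset.exists_max_image _ id hne
  rw [Finset.mem_filter] at hi
  have hx : x ∈ (chartAt (EuclideanSpace ℝ (Fin m)) i.1).source := by
    by_contra hx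
    refine hi.2 ?_
    rw [hv.congr (b := 0) (notMem_tsupport_iff_eventuallyEq.1 fun h' => hx (hs i h')), map_zero]
  obtain ⟨w, rfl⟩ := hv.exists_eq_chartDeriv hx
  obtain ⟨k, hk⟩ := ha i x hx w hi.2
  refine hk ?_
  rw [← h k, hsum, hsum, ← Finset.sum_erase_add _ _ hi.1, ← Finset.sum_erase_add _ _ hi.1]
  simp only [lt_irrefl, if_false, Pi.zero_apply, zero_mul, add_zero, add_left_inj]
  refine Finset.sum_congr rfl fun j hj => ?_
  rw [Finset.mem_erase] at hj
  split_ifs with hji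
  · rfl
  · have : chartDeriv hx w (F j) = 0 := by
      by_contra h'
      exact hji (lt_of_le_of_ne (hmax j (Finset.mem_filter.2 ⟨hj.2, h'⟩)) hj.1)
    rw [this, mul_zero, mul_zero]

end Immersion

end HigherDerivation

namespace HigherDerivation

open Filter Set Topology

/-! ### Gluing local left inverses into a dual basis. -/

section DualBasis

variable {m : ℕ} {M : Type*} [TopologicalSpace M] [ChartedSpace (EuclideanSpace ℝ (Fin m)) M]

/-- The sum of a locally finite family of derivations. -/
noncomputable def locallyFiniteSumDerivation {ι : Type*} (F : ι → C^∞⟮𝓡 m, M; ℝ⟯)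
    (hF : LocallyFinite fun i => Function.support (F i))
    (X : ι → Derivation ℝ C^∞⟮𝓡 m, M; ℝ⟯ C^∞⟮𝓡 m, M; ℝ⟯)
    (hX : ∀ i a, Function.support (X i a) ⊆ Function.support (F i)) :
    Derivation ℝ C^∞⟮𝓡 m, M; ℝ⟯ C^∞⟮𝓡 m, M; ℝ⟯ :=
  have hfin (a : C^∞⟮𝓡 m, M; ℝ⟯) (x : M) : (Function.support fun i => X i a x).Finite :=
    (hF.point_finite x).subset fun i hi => hX i a hi
  Derivation.mk'
    { toFun := fun a => ⟨fun x => ∑ᶠ i, X i a x,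
        contMDiff_finsum (fun i => (X i a).contMDiff) (hF.subset fun i => hX i a)⟩
      map_add' := fun a b => by
        ext x
        change ∑ᶠ i, X i (a + b) x = ∑ᶠ i, X i a x + ∑ᶠ i, X i b x
        rw [← finsum_add_distrib (hfin a x) (hfin b x)]
        exact finsum_congr fun i => by rw [map_add]; rfl
      map_smul' := fun r a => by
        ext x
        change ∑ᶠ i, X i (r • a) x = r * ∑ᶠ i, X i a x
        rw [mul_finsum]
        exact finsum_congr fun i => by rw [(X i).map_smul]; rfl }
    fun a b => by
      ext x
      change ∑ᶠ i, X i (a * b) x = a x * ∑ᶠ i, X i b x + b x * ∑ᶠ i, X i a x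
      rw [mul_finsum, mul_finsum]
      refine Eq.trans (finsum_congr fun i => ?_) (finsum_add_distrib
        ((hfin b x).subset (Function.support_const_smul_subset (a x) _))
        ((hfin a x).subset (Function.support_const_smul_subset (b x) _)))
      rw [Derivation.leibniz]
      rfl

/-- The value of a derivation at a point. -/
noncomputable def derivationAt (x : M) (Y : Derivation ℝ C^∞⟮𝓡 m, M; ℝ⟯ C^∞⟮𝓡 m, M; ℝ⟯) :
    C^∞⟮𝓡 m, M; ℝ⟯ →ₗ[ℝ] ℝ where
  toFun a := Y a x
  map_add' a b := by rw [map_add]; rfl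
  map_smul' r a := by rw [Y.map_smul]; rfl

theorem isPointDerivation_derivationAt (x : M)
    (Y : Derivation ℝ C^∞⟮𝓡 m, M; ℝ⟯ C^∞⟮𝓡 m, M; ℝ⟯) : IsPointDerivation x (derivationAt x Y) := by
  intro a b
  change Y (a * b) x = a x * Y b x + b x * Y a x
  rw [Derivation.leibniz]
  rfl

variable [IsManifold (𝓡 m) ∞ M]

/-- The vector field with coordinates `w` in the chart at `c`, multiplied by `F`. -/
noncomputable def chartDerivation (c : M) (F : C^∞⟮𝓡 m, M; ℝ⟯)
    (hF : tsupport F ⊆ (chartAt (EuclideanSpace ℝ (Fin m)) c).source)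
    (w : EuclideanSpace ℝ (Fin m) → EuclideanSpace ℝ (Fin m))
    (hw : ∀ x ∈ tsupport F, ContDiffAt ℝ ∞ w (extChartAt (𝓡 m) c x)) :
    Derivation ℝ C^∞⟮𝓡 m, M; ℝ⟯ C^∞⟮𝓡 m, M; ℝ⟯ :=
  have hsm (a : C^∞⟮𝓡 m, M; ℝ⟯) (x : M) (hx : x ∈ tsupport F) :
      ContMDiffAt (𝓡 m) 𝓘(ℝ, ℝ) ∞ (fun x => fderiv ℝ (a ∘ (extChartAt (𝓡 m) c).symm)
        (extChartAt (𝓡 m) c x) (w (extChartAt (𝓡 m) c x))) x :=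
    ((((contDiffAt_comp_symm c a (mem_target_of_mem_source (hF hx))).fderiv_right
      (by simp)).clm_apply (hw x hx)).contMDiffAt).comp x (contMDiffAt_extChartAt' (hF hx))
  -- Outside the chart `F` vanishes, so each derivation axiom reduces to the one for `chartDeriv`.
  have hpt (a b : C^∞⟮𝓡 m, M; ℝ⟯)
      (h : ∀ x (hx : x ∈ (chartAt (EuclideanSpace ℝ (Fin m)) c).source),
        F x * chartDeriv hx (w (extChartAt (𝓡 m) c x)) a = b x) (hb : ∀ x, F x = 0 → b x = 0) :
      mulOfTsupport F _ (hsm a) = b := by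
    ext x
    change F x * _ = b x
    by_cases hx : F x = 0
    · rw [hx, hb x hx, zero_mul]
    · exact h x (hF (subset_tsupport _ hx))
  Derivation.mk'
    { toFun := fun a => mulOfTsupport F _ (hsm a)
      map_add' := fun a b => hpt _ _
        (fun x hx => by rw [map_add, mul_add]; rfl)
        fun x hx => by
          change F x * _ + F x * _ = 0
          rw [hx, zero_mul, zero_mul, add_zero]
      map_smul' := fun r a => hpt _ _
        (fun x hx => by rw [map_smul, smul_eq_mul, mul_left_comm]; rfl)
        fun x hx => by
          change r * (F x * _) = 0
          rw [hx, zero_mul, mul_zero] }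
    fun a b => hpt _ _
      (fun x hx => by
        rw [isPointDerivation_chartDeriv hx _ a b, mul_add, mul_left_comm, mul_left_comm (F x)]
        rfl)
      fun x hx => by
        change a x * (F x * _) + b x * (F x * _) = 0
        rw [hx, zero_mul, zero_mul, mul_zero, mul_zero, add_zero]

theorem chartDerivation_apply {c : M} {F : C^∞⟮𝓡 m, M; ℝ⟯}
    (hF : tsupport F ⊆ (chartAt (EuclideanSpace ℝ (Fin m)) c).source)
    {w : EuclideanSpace ℝ (Fin m) → EuclideanSpace ℝ (Fin m)}
    (hw : ∀ x ∈ tsupport F, ContDiffAt ℝ ∞ w (extChartAt (𝓡 m) c x)) (a : C^∞⟮𝓡 m, M; ℝ⟯)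
    (x : M) : chartDerivation c F hF w hw a x =
      F x * fderiv ℝ (a ∘ (extChartAt (𝓡 m) c).symm) (extChartAt (𝓡 m) c x)
        (w (extChartAt (𝓡 m) c x)) := rfl

variable [T2Space M]

theorem exists_partition [ParacompactSpace M] (U : M → Set M) (hU : ∀ c, U c ∈ 𝓝 c) :
    ∃ ρ : M → C^∞⟮𝓡 m, M; ℝ⟯, (∀ c, tsupport (ρ c) ⊆ U c) ∧
      (LocallyFinite fun c => Function.support (ρ c)) ∧ ∀ x, ∑ᶠ c, ρ c x = 1 := by
  obtain ⟨F, hs, hf, h0, hne⟩ := exists_locallyFinite_cover (m := m) U hU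
  have hpos (x : M) : ∑ᶠ c, F c x ≠ 0 := by
    obtain ⟨c, hc⟩ := hne x
    exact (finsum_pos (fun c => h0 c x) ⟨c, lt_of_le_of_ne (h0 c x) (Ne.symm hc)⟩
      (hf.point_finite x)).ne'
  let s : C^∞⟮𝓡 m, M; ℝ⟯ := ⟨fun x => (∑ᶠ c, F c x)⁻¹,
    (contMDiff_finsum (fun c => (F c).contMDiff) hf).inv₀ hpos⟩
  refine ⟨fun c => F c * s, fun c => ?_, hf.subset fun c => ?_, fun x => ?_⟩
  · exact (tsupport_mul_subset_left (f := F c) (g := s)).trans (hs c)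
  · exact Function.support_mul_subset_left (F c) s
  · change ∑ᶠ c, F c x * (∑ᶠ c, F c x)⁻¹ = 1
    rw [← finsum_mul, mul_inv_cancel₀ (hpos x)]

/-- If `L` is a left inverse of the differential `J` at `c`, then `B = L ∘ J` is the identity there
and invertible nearby, and `B⁻¹ ∘ L` is a left inverse of `J` depending smoothly on the point. The
`w k` are its columns. -/
theorem exists_local_leftInverse {ι : Type} [Fintype ι] [DecidableEq ι]
    {f : ι → C^∞⟮𝓡 m, M; ℝ⟯} (c : M)
    (hf : ∀ v : C^∞⟮𝓡 m, M; ℝ⟯ →ₗ[ℝ] ℝ, IsPointDerivation c v → (∀ k, v (f k) = 0) → v = 0) :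
    ∃ U ∈ 𝓝 c, U ⊆ (chartAt (EuclideanSpace ℝ (Fin m)) c).source ∧
      ∃ w : ι → EuclideanSpace ℝ (Fin m) → EuclideanSpace ℝ (Fin m),
        (∀ k, ∀ x ∈ U, ContDiffAt ℝ ∞ (w k) (extChartAt (𝓡 m) c x)) ∧
        ∀ x ∈ U, ∀ u, ∑ k, fderiv ℝ (f k ∘ (extChartAt (𝓡 m) c).symm) (extChartAt (𝓡 m) c x) u •
          w k (extChartAt (𝓡 m) c x) = u := by
  let E := EuclideanSpace ℝ (Fin m)
  set φ := extChartAt (𝓡 m) c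
  let J (y : E) : E →L[ℝ] ι → ℝ := ContinuousLinearMap.pi fun k => fderiv ℝ (f k ∘ φ.symm) y
  have hc := mem_chart_source E c
  have hJ : Function.Injective (J (φ c)) := by
    rw [injective_iff_map_eq_zero]
    intro w hw
    exact eq_zero_of_chartDeriv_eq_zero hc
      (hf _ (isPointDerivation_chartDeriv hc w) fun k => congrFun hw k)
  obtain ⟨L, hL⟩ := (J (φ c)).toLinearMap.exists_leftInverse_of_injective
    (LinearMap.ker_eq_bot.2 hJ)
  let L' : (ι → ℝ) →L[ℝ] E := LinearMap.toContinuousLinearMap L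
  let B (y : E) : E →L[ℝ] E := L'.comp (J y)
  have hB (y) (hy : y ∈ φ.target) : ContDiffAt ℝ ∞ B y := by
    have h1 : ContDiffAt ℝ ∞ (fun y => fun k => fderiv ℝ (f k ∘ φ.symm) y) y :=
      contDiffAt_pi.2 fun k => (contDiffAt_comp_symm c (f k) hy).fderiv_right (by simp)
    exact contDiffAt_const.clm_comp
      ((ContinuousLinearMap.piEquivL ℝ E fun _ : ι => ℝ).contDiff.contDiffAt.comp y h1)
  have hB1 : B (φ c) = 1 := by
    ext1 u
    exact LinearMap.congr_fun hL u
  let U : Set M := {x | x ∈ (chartAt E c).source ∧ IsUnit (B (φ x))}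
  refine ⟨U, ?_, fun x hx => hx.1, fun k y => Ring.inverse (B y) (L' (Pi.single k 1)),
    fun k x hx => ?_, fun x hx u => ?_⟩
  · have hcont : ContinuousAt (fun x => B (φ x)) c :=
      (hB _ (mem_target_of_mem_source hc)).continuousAt.comp (continuousAt_extChartAt c)
    exact inter_mem ((chartAt E c).open_source.mem_nhds hc)
      (hcont.eventually (Units.isOpen.mem_nhds (show IsUnit (B (φ c)) from hB1 ▸ isUnit_one)))
  · obtain ⟨z, hz⟩ := hx.2
    have h1 : ContDiffAt ℝ ∞ Ring.inverse (B (φ x)) := hz ▸ contDiffAt_ringInverse ℝ z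
    exact (h1.comp _ (hB _ (mem_target_of_mem_source hx.1))).clm_apply contDiffAt_const
  · have h1 : ∑ k, J (φ x) u k • (Pi.single k 1 : ι → ℝ) = J (φ x) u := by
      simpa using (pi_eq_sum_univ' (J (φ x) u)).symm
    calc _ = Ring.inverse (B (φ x)) (L' (∑ k, J (φ x) u k • (Pi.single k 1 : ι → ℝ))) := by
          simp only [map_sum, map_smul]; rfl
      _ = (Ring.inverse (B (φ x)) * B (φ x)) u := by rw [h1]; rfl
      _ = u := by rw [Ring.inverse_mul_cancel _ hx.2]; rfl

theorem exists_isDualBasis [ParacompactSpace M] :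
    ∃ (f : Fin (2 * m + 1) → C^∞⟮𝓡 m, M; ℝ⟯)
      (X : Fin (2 * m + 1) → Derivation ℝ C^∞⟮𝓡 m, M; ℝ⟯ C^∞⟮𝓡 m, M; ℝ⟯), IsDualBasis f X := by
  obtain ⟨f, hf⟩ := exists_immersion (m := m) (M := M)
  choose U hU hUs w hw hwf using fun c => exists_local_leftInverse c (hf c)
  obtain ⟨ρ, hρs, hρf, hρ⟩ := exists_partition (m := m) U hU
  let X (k : Fin (2 * m + 1)) (c : M) : Derivation ℝ C^∞⟮𝓡 m, M; ℝ⟯ C^∞⟮𝓡 m, M; ℝ⟯ :=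
    chartDerivation c (ρ c) ((hρs c).trans (hUs c)) (w c k) fun x hx => hw c k x (hρs c hx)
  have hX (k c a) : Function.support (X k c a) ⊆ Function.support (ρ c) :=
    Function.support_mul_subset_left _ _
  refine ⟨f, fun k => locallyFiniteSumDerivation ρ hρf (X k) (hX k), fun Y a => ?_⟩
  ext x
  rw [← ContMDiffMap.coeFnRingHom_apply (∑ i, _), map_sum, Finset.sum_apply]
  change Y a x = ∑ k, Y (f k) x * ∑ᶠ c, X k c a x
  have hfin (k) : (Function.support fun c => X k c a x).Finite :=
    (hρf.point_finite x).subset fun c hc => hX k c a hc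
  -- At `x` the derivation `Y` is a tangent vector `u`; applying the differential of `a` to `u = ∑
  -- df_k(u) • w_k` gives the expansion, weighted by `ρ c x`.
  have hloc (c : M) : ∑ k, Y (f k) x * X k c a x = ρ c x * Y a x := by
    by_cases hx : ρ c x = 0
    · have h0 (k) : X k c a x = 0 := by
        change ρ c x * _ = 0
        rw [hx, zero_mul]
      simp [h0, hx]
    · have hxU := hρs c (subset_tsupport _ hx)
      obtain ⟨u, hu⟩ :=
        (isPointDerivation_derivationAt x Y).exists_eq_chartDeriv (hUs c hxU)
      have hY (b) : Y b x = fderiv ℝ (b ∘ (extChartAt (𝓡 m) c).symm) (extChartAt (𝓡 m) c x) u :=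
        LinearMap.congr_fun hu b
      conv_rhs => rw [hY a, ← hwf c x hxU u, map_sum, Finset.mul_sum]
      refine Finset.sum_congr rfl fun k _ => ?_
      rw [hY (f k), chartDerivation_apply, map_smul, smul_eq_mul, mul_left_comm]
  have h1 (k) : Y (f k) x * ∑ᶠ c, X k c a x = ∑ᶠ c, Y (f k) x * X k c a x :=
    mul_finsum _ _
  simp only [h1]
  have h2 := finsum_sum_comm Finset.univ (fun c k => Y (f k) x * X k c a x) fun k _ =>
    (hfin k).subset (Function.support_const_smul_subset (Y (f k) x) _)
  rw [← h2]
  simp only [hloc]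
  rw [← finsum_mul, hρ, one_mul]

end DualBasis

end HigherDerivation

theorem mainTheorem4 (m : ℕ) (M : Type*) [TopologicalSpace M]
    [ChartedSpace (EuclideanSpace ℝ (Fin m)) M] [IsManifold (𝓡 m) ∞ M]
    [T2Space M] [ParacompactSpace M]
    (r : ℕ) (D : Module.End ℝ C^∞⟮𝓡 m, M; ℝ⟯)
    (hD : HigherDerivation.IsHigherDerivation ℝ C^∞⟮𝓡 m, M; ℝ⟯ r D) :
    D ∈ HigherDerivation.SDerLE ℝ C^∞⟮𝓡 m, M; ℝ⟯ r := by
  obtain ⟨f, X, h⟩ := HigherDerivation.exists_isDualBasis (m := m) (M := M)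
  exact h.mem_SDerLE hD
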